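/- Let $\mathbb K$ be an arbitrary field, $n\ge 0$ an integer, $\alpha,\beta\in\mathbb K$, and $\phi\in\mathbb K[t_1,\dots,t_n]$ a polynomial. Let $A$ be the (unital, associative) $\mathbb K$-algebra generated by $u,d,t_1,\dots,t_n$ subject to the relations $$t_it_j=t_jt_i,\qquad t_iu=ut_i,\qquad t_id=dt_i\qquad(1\le i,j\le n),$$ $$d^2u=\alpha\,dud+\beta\,ud^2+\phi(t_1,\dots,t_n)\,d,\qquad du^2=\alpha\,udu+\beta\,u^2d+u\,\phi(t_1,\dots,t_n).$$ Then the monomials $u^i(du)^jd^kt_1^{m_1}\cdots t_n^{m_n}$ with $i,j,k,m_1,\dots,m_n\ge 0$ form a $\mathbb K$-basis of $A$ (monomials with different exponents being different elements of $A$). Furthermore, $A$ has Gelfand–Kirillov dimension $n+3$, that is, $$\sup_V\ \limsup_{m\to\infty}\frac{\log\dim_{\mathbb K}(\mathbb K+V+V^2+\cdots+V^m)}{\log m}=n+3,$$ where $V$ runs over the finite-dimensional $\mathbb K$-subspaces of $A$. -/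

import Mathlib

/-- The generators `u`, `d`, `t 0, …, t (n - 1)`. -/
inductive DownUpGen (n : ℕ) : Type
  | u : DownUpGen n
  | d : DownUpGen n
  | t (i : Fin n) : DownUpGen n

namespace DownUp

/-- The ordered product `x 0 ^ m 0 * x 1 ^ m 1 * ⋯ * x (n - 1) ^ m (n - 1)`. -/
def orderedMonomial {A : Type*} [Monoid A] {n : ℕ} (x : Fin n → A) (m : Fin n → ℕ) : A :=
  (List.ofFn fun i => x i ^ m i).prod

/-- The value `∑ c_m x_1 ^ m_1 ⋯ x_n ^ m_n` of the polynomial `φ = ∑ c_m t_1 ^ m_1 ⋯ t_n ^ m_n`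
at elements of a possibly noncommutative algebra, each monomial being written in the order
`x 0, …, x (n - 1)`. -/
noncomputable def orderedEval {K A : Type*} [Field K] [Ring A] [Algebra K A] {n : ℕ}
    (x : Fin n → A) (φ : MvPolynomial (Fin n) K) : A :=
  ∑ m ∈ φ.support, φ.coeff m • orderedMonomial x m

section Relations

variable {K : Type*} [Field K] {n : ℕ}

/-- The free generator `u` of `K⟨u, d, t_1, …, t_n⟩`. -/
abbrev freeU (K : Type*) [Field K] (n : ℕ) : FreeAlgebra K (DownUpGen n) :=
  FreeAlgebra.ι K DownUpGen.u

/-- The free generator `d` of `K⟨u, d, t_1, …, t_n⟩`. -/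
abbrev freeD (K : Type*) [Field K] (n : ℕ) : FreeAlgebra K (DownUpGen n) :=
  FreeAlgebra.ι K DownUpGen.d

/-- The free generators `t_i` of `K⟨u, d, t_1, …, t_n⟩`. -/
abbrev freeT (K : Type*) [Field K] (n : ℕ) (i : Fin n) : FreeAlgebra K (DownUpGen n) :=
  FreeAlgebra.ι K (DownUpGen.t i)

/-- The defining relations of the down-up algebra over `K[t_1, …, t_n]`. -/
inductive Rel (α β : K) (φ : MvPolynomial (Fin n) K) :
    FreeAlgebra K (DownUpGen n) → FreeAlgebra K (DownUpGen n) → Prop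
  | t_comm_t (i j : Fin n) :
      Rel α β φ (freeT K n i * freeT K n j) (freeT K n j * freeT K n i)
  | t_comm_u (i : Fin n) :
      Rel α β φ (freeT K n i * freeU K n) (freeU K n * freeT K n i)
  | t_comm_d (i : Fin n) :
      Rel α β φ (freeT K n i * freeD K n) (freeD K n * freeT K n i)
  | ddu :
      Rel α β φ (freeD K n ^ 2 * freeU K n)
        (α • (freeD K n * freeU K n * freeD K n) + β • (freeU K n * freeD K n ^ 2)
          + orderedEval (freeT K n) φ * freeD K n)
  | duu :
      Rel α β φ (freeD K n * freeU K n ^ 2)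
        (α • (freeU K n * freeD K n * freeU K n) + β • (freeU K n ^ 2 * freeD K n)
          + freeU K n * orderedEval (freeT K n) φ)

end Relations

end DownUp

/-- The down-up algebra over `K[t_1, …, t_n]`: the `K`-algebra with generators
`u, d, t_1, …, t_n` and the relations `DownUp.Rel α β φ`. -/
abbrev DownUpAlgebra {K : Type*} [Field K] {n : ℕ} (α β : K) (φ : MvPolynomial (Fin n) K) :
    Type _ :=
  RingQuot (DownUp.Rel α β φ)

namespace DownUpAlgebra

variable {K : Type*} [Field K] {n : ℕ} (α β : K) (φ : MvPolynomial (Fin n) K)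

/-- The image of a generator in the down-up algebra. -/
noncomputable def gen (x : DownUpGen n) : DownUpAlgebra α β φ :=
  RingQuot.mkAlgHom K (DownUp.Rel α β φ) (FreeAlgebra.ι K x)

/-- The generator `u`. -/
noncomputable def u : DownUpAlgebra α β φ := gen α β φ DownUpGen.u

/-- The generator `d`. -/
noncomputable def d : DownUpAlgebra α β φ := gen α β φ DownUpGen.d

/-- The generators `t_i`. -/
noncomputable def t (i : Fin n) : DownUpAlgebra α β φ := gen α β φ (DownUpGen.t i)

/-- The element `u ^ i * (d * u) ^ j * d ^ k * t_1 ^ m_1 ⋯ t_n ^ m_n`, where `e = (i, j, k, m)`. -/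
noncomputable def monomial (e : ℕ × ℕ × ℕ × (Fin n → ℕ)) : DownUpAlgebra α β φ :=
  u α β φ ^ e.1 * (d α β φ * u α β φ) ^ e.2.1 * d α β φ ^ e.2.2.1
    * DownUp.orderedMonomial (t α β φ) e.2.2.2

end DownUpAlgebra

/-- The Gelfand–Kirillov dimension of a (nonzero) algebra `A` over a field `K`: the supremum over
all finite-dimensional subspaces `V` of
`limsup_{m → ∞} log dim (K + V + V ^ 2 + ⋯ + V ^ m) / log m`. -/
noncomputable def gelfandKirillovDim (K A : Type*) [Field K] [Ring A] [Algebra K A] : EReal :=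
  ⨆ (V : Submodule K A) (_ : FiniteDimensional K V),
    Filter.limsup
      (fun m : ℕ =>
        ((Real.log (Module.finrank K (⨆ i ∈ Finset.range (m + 1), V ^ i : Submodule K A))
          / Real.log m : ℝ) : EReal))
      Filter.atTop

/-! Write R = K[t_1, …, t_n], which maps to the centre of A. Spanning is a rewriting argument:
`pbwSpan` collects the ordered monomials, and it is stable under left multiplication by d because
d²u and du² can be straightened; the proof is by induction on the exponent of du
(`IsDownUpPair.d_mul_pow_mem`).

Independence needs a model. If β ≠ 0, then σ : x ↦ w ↦ αw + βx + φ is an automorphism of F[x, w],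
and u, d act on sequences of polynomials so that ud and du are multiplication by x and w
(`linearIndependent_model`). For β = 0 this σ is not invertible, so β is first made an indeterminate
X. Over R[X] the model yields an algebra that is free on the monomials, and freeness, unlike mere
independence, survives the specialization X ↦ β (`exists_linearIndependent_isDownUpPair`). Mapping A
to the result gives independence over R, hence over K after expanding R in its monomials.

For the dimension, give u and d the weight q = deg φ + 1 and each t_i the weight 1. Straightening
does not raise weights, since deg φ ≤ 2q. The resulting multiplicative filtration has m-th piece of
dimension at most (m+1)^(n+3), which bounds the growth of every V; the span of 1 and the generators
attains the exponent n + 3. -/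

section Filtration

/-! ### Straightening products into ordered monomials -/

variable {R S : Type*} [CommRing R] [Ring S] [Algebra R S]

/-- The span of the elements `u ^ i * (d * u) ^ b * d ^ k * e` with `e ∈ E l`, `i + b ≤ j` and
`q * (i + 2 * b + k) + l ≤ m`. -/
def pbwSpan (R : Type*) {S : Type*} [CommRing R] [Ring S] [Algebra R S]
    (u d : S) (E : ℕ → Set S) (q j m : ℕ) : Submodule R S :=
  Submodule.span R {x | ∃ i b k l, ∃ e ∈ E l, i + b ≤ j ∧ q * (i + 2 * b + k) + l ≤ m ∧
    x = u ^ i * (d * u) ^ b * d ^ k * e}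

/-- The down-up relations for `u` and `d` with parameters `α`, `β` and an element `f` commuting
with `u` and `d`. -/
structure IsDownUpPair (α β : R) (f u d : S) : Prop where
  comm_u : Commute f u
  comm_d : Commute f d
  ddu : d ^ 2 * u = α • (d * u * d) + β • (u * d ^ 2) + f * d
  duu : d * u ^ 2 = α • (u * d * u) + β • (u ^ 2 * d) + u * f

variable {u d : S} {E : ℕ → Set S} {q j m : ℕ}

theorem mem_pbwSpan {i b k l : ℕ} {e : S} (he : e ∈ E l) (hj : i + b ≤ j)
    (hm : q * (i + 2 * b + k) + l ≤ m) :
    u ^ i * (d * u) ^ b * d ^ k * e ∈ pbwSpan R u d E q j m :=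
  Submodule.subset_span ⟨i, b, k, l, e, he, hj, hm, rfl⟩

theorem pbwSpan_mono {j' m' : ℕ} (hj : j ≤ j') (hm : m ≤ m') :
    pbwSpan R u d E q j m ≤ pbwSpan R u d E q j' m' := by
  refine Submodule.span_mono ?_
  rintro _ ⟨i, b, k, l, e, he, h1, h2, rfl⟩
  exact ⟨i, b, k, l, e, he, h1.trans hj, h2.trans hm, rfl⟩

theorem mul_mem_of_mul_mem_span {s : Set S} {N : Submodule R S} {a : S}
    (h : ∀ x ∈ s, a * x ∈ N) {x : S} (hx : x ∈ Submodule.span R s) : a * x ∈ N := by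
  have : Submodule.span R s ≤ N.comap (LinearMap.mulLeft R a) :=
    Submodule.span_le.2 fun x hx => h x hx
  exact this hx

theorem u_mul_mem_pbwSpan {x : S} (hx : x ∈ pbwSpan R u d E q j m) :
    u * x ∈ pbwSpan R u d E q (j + 1) (m + q) := by
  refine mul_mem_of_mul_mem_span ?_ hx
  rintro _ ⟨i, b, k, l, e, he, h1, h2, rfl⟩
  have : u * (u ^ i * (d * u) ^ b * d ^ k * e) = u ^ (i + 1) * (d * u) ^ b * d ^ k * e := by
    simp only [pow_succ', mul_assoc]
  rw [this]
  exact mem_pbwSpan he (by lia) (by ring_nf at h2 ⊢; lia)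

theorem u_pow_mul_mem_pbwSpan {x : S} (hx : x ∈ pbwSpan R u d E q j m) (i : ℕ) :
    u ^ i * x ∈ pbwSpan R u d E q (j + i) (m + q * i) := by
  induction i with
  | zero => simpa using hx
  | succ i ih =>
    have := u_mul_mem_pbwSpan ih
    rwa [← mul_assoc, ← pow_succ', add_assoc, add_assoc, ← mul_add_one] at this

variable {α β : R} {f : S}

/-- Iterating the relation for du² moves d past a power of u. Only the shape of the three terms
matters later, so the coefficients stay existential. -/
theorem IsDownUpPair.d_mul_u_pow (h : IsDownUpPair α β f u d) (i : ℕ) : ∃ a b c : R,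
    d * u ^ (i + 1) = a • (u ^ i * (d * u)) + b • (u ^ (i + 1) * d) + c • (u ^ i * f) := by
  induction i with
  | zero => exact ⟨1, 0, 0, by simp⟩
  | succ i ih =>
    obtain ⟨a, b, c, hi⟩ := ih
    -- On multiplying by u on the right, the a-term splits into all three shapes, the b-term becomes
    -- u^(i+1)(du), and f moves past u.
    refine ⟨α * a + b, β * a, a + c, ?_⟩
    have h1 : u ^ i * (d * u) * u = α • (u ^ (i + 1) * (d * u)) + β • (u ^ (i + 1 + 1) * d)
        + u ^ (i + 1) * f := by
      have : u ^ i * (d * u) * u = u ^ i * (d * u ^ 2) := by simp only [pow_two, mul_assoc]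
      rw [this, h.duu]
      simp only [mul_add, mul_smul_comm, pow_succ, pow_zero, one_mul, mul_assoc]
    have h2 : u ^ i * f * u = u ^ (i + 1) * f := by
      rw [mul_assoc, h.comm_u.eq, ← mul_assoc, pow_succ]
    have h3 : d * u ^ (i + 1 + 1) = d * u ^ (i + 1) * u := by rw [pow_succ, mul_assoc]
    rw [h3, hi, add_mul, add_mul, smul_mul_assoc, smul_mul_assoc,
      smul_mul_assoc, h1, h2, mul_assoc (u ^ (i + 1))]
    module

theorem IsDownUpPair.f_mul_mem_pbwSpan (h : IsDownUpPair α β f u d)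
    (hE : ∀ l, ∀ e ∈ E l, f * e ∈ E (l + 2 * q)) {x : S} (hx : x ∈ pbwSpan R u d E q j m) :
    f * x ∈ pbwSpan R u d E q j (m + 2 * q) := by
  refine mul_mem_of_mul_mem_span ?_ hx
  rintro _ ⟨i, b, k, l, e, he, h1, h2, rfl⟩
  have hc : Commute f (u ^ i * (d * u) ^ b * d ^ k) :=
    ((h.comm_u.pow_right i).mul_right ((h.comm_d.mul_right h.comm_u).pow_right b)).mul_right
      (h.comm_d.pow_right k)
  rw [← mul_assoc, hc.eq, mul_assoc]
  exact mem_pbwSpan (hE l e he) h1 (by lia)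

/-- The assumption `hd` is limited to exponents b ≤ j, which is exactly what the strong induction in
`IsDownUpPair.d_mul_pow_mem` can supply. This is why `pbwSpan` carries the bound j besides the
weight. -/
theorem IsDownUpPair.d_mul_u_mul_mem_of_d_mul_pow (h : IsDownUpPair α β f u d)
    (hE : ∀ l, ∀ e ∈ E l, f * e ∈ E (l + 2 * q))
    (hd : ∀ b ≤ j, ∀ k l, ∀ e ∈ E l,
      d * ((d * u) ^ b * d ^ k * e) ∈ pbwSpan R u d E q b (q * (2 * b + k + 1) + l))
    {x : S} (hx : x ∈ pbwSpan R u d E q j m) :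
    d * (u * x) ∈ pbwSpan R u d E q (j + 1) (m + 2 * q) := by
  rw [← mul_assoc]
  refine mul_mem_of_mul_mem_span ?_ hx
  rintro _ ⟨i, b, k, l, e, he, h1, h2, rfl⟩
  obtain ⟨a₁, a₂, a₃, hi⟩ := h.d_mul_u_pow i
  have : d * u * (u ^ i * (d * u) ^ b * d ^ k * e) =
      a₁ • (u ^ i * (d * u) ^ (b + 1) * d ^ k * e)
      + a₂ • (u ^ (i + 1) * (d * ((d * u) ^ b * d ^ k * e)))
      + a₃ • (u ^ i * (f * ((d * u) ^ b * d ^ k * e))) := by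
    calc d * u * (u ^ i * (d * u) ^ b * d ^ k * e)
        = d * u ^ (i + 1) * ((d * u) ^ b * d ^ k * e) := by simp only [pow_succ' u, mul_assoc]
      _ = _ := by
        rw [hi, pow_succ' (d * u)]
        simp only [add_mul, smul_mul_assoc, mul_assoc]
  rw [this]
  refine add_mem (add_mem ?_ ?_) ?_ <;> refine Submodule.smul_mem _ _ ?_
  · exact mem_pbwSpan he (by lia) (by ring_nf at h2 ⊢; lia)
  · exact pbwSpan_mono (by lia) (by ring_nf at h2 ⊢; lia)
      (u_pow_mul_mem_pbwSpan (hd b (by lia) k l e he) (i + 1))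
  · have hm : (d * u) ^ b * d ^ k * e ∈ pbwSpan R u d E q b (q * (2 * b + k) + l) := by
      simpa using mem_pbwSpan (R := R) (u := u) (d := d) (i := 0) (k := k) he
        (show 0 + b ≤ b by lia) (show q * (0 + 2 * b + k) + l ≤ q * (2 * b + k) + l by simp)
    exact pbwSpan_mono (by lia) (by ring_nf at h2 ⊢; lia)
      (u_pow_mul_mem_pbwSpan (h.f_mul_mem_pbwSpan hE hm) i)

theorem IsDownUpPair.d_mul_mem_of_d_mul_pow (h : IsDownUpPair α β f u d)
    (hE : ∀ l, ∀ e ∈ E l, f * e ∈ E (l + 2 * q))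
    (hd : ∀ b ≤ j, ∀ k l, ∀ e ∈ E l,
      d * ((d * u) ^ b * d ^ k * e) ∈ pbwSpan R u d E q b (q * (2 * b + k + 1) + l))
    {x : S} (hx : x ∈ pbwSpan R u d E q j m) :
    d * x ∈ pbwSpan R u d E q j (m + q) := by
  refine mul_mem_of_mul_mem_span ?_ hx
  rintro _ ⟨i, b, k, l, e, he, h1, h2, rfl⟩
  cases i with
  | zero =>
    simp only [pow_zero, one_mul]
    exact pbwSpan_mono (by lia) (by ring_nf at h2 ⊢; lia) (hd b (by lia) k l e he)
  -- Splitting off one u leaves a monomial with i + b ≤ j - 1, so the bound returns to j.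
  | succ i =>
    have := h.d_mul_u_mul_mem_of_d_mul_pow hE (j := i + b)
      (fun c hc => hd c (by lia)) (mem_pbwSpan (R := R) (u := u) (d := d) (k := k) he le_rfl le_rfl)
    simp only [pow_succ' u, mul_assoc] at this ⊢
    exact pbwSpan_mono (by lia) (by ring_nf at h2 ⊢; lia) this

/-- With y = (du)^b d^k e, the product d(du)^(b+1) d^k e equals d²u y. The relation turns it into
words applied to dy, which the induction hypothesis places at level b; every further step needs
exponents at most b. -/
theorem IsDownUpPair.d_mul_pow_mem (h : IsDownUpPair α β f u d)
    (hE : ∀ l, ∀ e ∈ E l, f * e ∈ E (l + 2 * q)) (b k l : ℕ) (e : S) (he : e ∈ E l) :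
    d * ((d * u) ^ b * d ^ k * e) ∈ pbwSpan R u d E q b (q * (2 * b + k + 1) + l) := by
  induction b using Nat.strong_induction_on generalizing k l e with
  | _ b ih =>
    cases b with
    | zero =>
      have := mem_pbwSpan (R := R) (u := u) (d := d) (i := 0) (b := 0) (k := k + 1) he
          (show 0 + 0 ≤ 0 by lia)
          (show q * (0 + 2 * 0 + (k + 1)) + l ≤ q * (2 * 0 + k + 1) + l by simp)
      simpa [pow_succ', mul_assoc] using this
    | succ b =>
      have hb := fun c (hc : c ≤ b) => ih c (by lia)
      have hd' : ∀ x, d * (d * (u * x)) = α • (d * (u * (d * x))) + β • (u * (d * (d * x)))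
          + f * (d * x) := fun x => by
        have := congrArg (· * x) h.ddu
        simpa only [pow_two, add_mul, smul_mul_assoc, mul_assoc] using this
      have hy := ih b (by lia) k l e he
      set y := (d * u) ^ b * d ^ k * e with hy'
      have : d * ((d * u) ^ (b + 1) * d ^ k * e) = α • (d * (u * (d * y)))
          + β • (u * (d * (d * y))) + f * (d * y) := by
        rw [pow_succ', ← hd', hy']
        simp only [mul_assoc]
      rw [this]
      refine add_mem (add_mem (Submodule.smul_mem _ _ ?_) (Submodule.smul_mem _ _ ?_)) ?_
      · exact pbwSpan_mono le_rfl (by ring_nf; lia) (h.d_mul_u_mul_mem_of_d_mul_pow hE hb hy)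
      · exact pbwSpan_mono le_rfl (by ring_nf; lia)
          (u_mul_mem_pbwSpan (h.d_mul_mem_of_d_mul_pow hE hb hy))
      · exact pbwSpan_mono (by lia) (by ring_nf; lia) (h.f_mul_mem_pbwSpan hE hy)

theorem IsDownUpPair.d_mul_mem_pbwSpan (h : IsDownUpPair α β f u d)
    (hE : ∀ l, ∀ e ∈ E l, f * e ∈ E (l + 2 * q)) {x : S} (hx : x ∈ pbwSpan R u d E q j m) :
    d * x ∈ pbwSpan R u d E q j (m + q) :=
  h.d_mul_mem_of_d_mul_pow hE (fun b _ => h.d_mul_pow_mem hE b) hx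

end Filtration

/-! ### Independence in an operator model for β ≠ 0 -/

/-- In a relation, π kills every term with a positive power of U, so the zeroth layer vanishes.
Injectivity then cancels one U, and induction on the number of layers finishes. -/
theorem linearIndependent_pow_apply {F M M' ι : Type*} [CommRing F] [AddCommGroup M] [Module F M]
    [AddCommGroup M'] [Module F M'] (U : Module.End F M) (π : M →ₗ[F] M') (v : ι → M)
    (hU : Function.Injective U) (hπU : ∀ x, π (U x) = 0) (hv : LinearIndependent F (π ∘ v)) :
    LinearIndependent F (fun p : ℕ × ι => (U ^ p.1) (v p.2)) := by
  have key : ∀ (N : ℕ) (c : ℕ → ι →₀ F),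
      ∑ i ∈ Finset.range N, (U ^ i) (Finsupp.linearCombination F v (c i)) = 0 →
      ∀ i < N, c i = 0 := by
    intro N
    induction N with
    | zero => simp
    | succ N ih =>
      intro c hc
      rw [Finset.sum_range_succ'] at hc
      simp only [pow_succ', Module.End.mul_apply, pow_zero, Module.End.one_apply,
        ← map_sum] at hc
      have h0 : c 0 = 0 := by
        have := congrArg π hc
        rw [map_add, hπU, zero_add, map_zero, Finsupp.apply_linearCombination] at this
        exact linearIndependent_iff.1 hv _ this
      rw [h0, map_zero, add_zero] at hc
      have h1 := ih (fun i => c (i + 1)) (hU (by rw [hc, map_zero]))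
      intro i hi
      cases i with
      | zero => exact h0
      | succ i => exact h1 i (by lia)
  rw [linearIndependent_iff]
  intro c hc
  obtain ⟨N, hN⟩ : ∃ N, c.curry.support ⊆ Finset.range N :=
    ⟨_, Finset.subset_range_sup_succ _⟩
  have h1 : ∑ i ∈ Finset.range N, (U ^ i) (Finsupp.linearCombination F v (c.curry i)) = 0 := by
    rw [← hc, Finsupp.linearCombination_apply, ← Finsupp.sum_curry_index c
      (fun i j a => a • (U ^ i) (v j)),
      Finsupp.sum_of_support_subset _ hN _ (by simp)]
    refine Finset.sum_congr rfl fun i _ => ?_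
    rw [Finsupp.linearCombination_apply, map_finsuppSum]
    simp
  have h2 := key N c.curry h1
  ext ⟨i, j⟩
  by_cases hi : i < N
  · simpa using DFunLike.congr_fun (h2 i hi) j
  · have : i ∉ c.curry.support := fun h => hi (Finset.mem_range.1 (hN h))
    simpa using DFunLike.congr_fun (Finsupp.notMem_support_iff.1 this) j

section Model

open MvPolynomial

variable {F : Type*} [Field F]

/-- The automorphism `x ↦ w`, `w ↦ α w + β x + φ` of `F[x, w]`. -/
noncomputable def twist (α β φ : F) (hβ : β ≠ 0) :
    MvPolynomial (Fin 2) F ≃ₐ[F] MvPolynomial (Fin 2) F :=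
  AlgEquiv.ofAlgHom
    (aeval ![X 1, C α * X 1 + C β * X 0 + C φ])
    (aeval ![C β⁻¹ * (X 1 - C α * X 0 - C φ), X 0])
    (by
      ext i : 1
      fin_cases i
      · have : (C β⁻¹ * C β : MvPolynomial (Fin 2) F) = 1 := by
          rw [← C_mul, inv_mul_cancel₀ hβ, C_1]
        simp [algebraMap_eq]
        linear_combination X 0 * this
      · simp)
    (by
      ext i : 1
      fin_cases i
      · simp
      · have : (C β⁻¹ * C β : MvPolynomial (Fin 2) F) = 1 := by
          rw [← C_mul, inv_mul_cancel₀ hβ, C_1]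
        simp [algebraMap_eq]
        linear_combination (X 1 - C α * X 0 - C φ) * this)

variable (α β φ : F) (hβ : β ≠ 0)

theorem twist_X_zero : twist α β φ hβ (X 0) = X 1 := by
  simp [twist]

theorem twist_X_one : twist α β φ hβ (X 1) = α • X 1 + β • X 0 + C φ := by
  simp [twist, smul_eq_C_mul]

/-- The operator `d`: shift the degree up and apply the twist. -/
noncomputable def modelD : Module.End F (ℤ → MvPolynomial (Fin 2) F) where
  toFun g k := twist α β φ hβ (g (k - 1))
  map_add' g h := by ext1; simp
  map_smul' c g := by ext1; simp

/-- The operator `u`: shift the degree down, apply the inverse twist and multiply by `x`. -/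
noncomputable def modelU : Module.End F (ℤ → MvPolynomial (Fin 2) F) where
  toFun g k := X 0 * (twist α β φ hβ).symm (g (k + 1))
  map_add' g h := by ext1; simp [mul_add]
  map_smul' c g := by ext1; simp

@[simp] theorem modelD_apply (g : ℤ → MvPolynomial (Fin 2) F) (k : ℤ) :
    modelD α β φ hβ g k = twist α β φ hβ (g (k - 1)) := rfl

@[simp] theorem modelU_apply (g : ℤ → MvPolynomial (Fin 2) F) (k : ℤ) :
    modelU α β φ hβ g k = X 0 * (twist α β φ hβ).symm (g (k + 1)) := rfl

theorem isDownUpPair_model :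
    IsDownUpPair α β (algebraMap F _ φ) (modelU α β φ hβ) (modelD α β φ hβ) where
  comm_u := Algebra.commutes _ _
  comm_d := Algebra.commutes _ _
  ddu := by
    ext1 g
    ext1 k
    simp [pow_two, twist_X_zero, twist_X_one, add_mul, sub_add_cancel, smul_eq_C_mul, mul_assoc]
  duu := by
    ext1 g
    ext1 k
    -- This relation needs σ⁻¹: applying it to σ(w) = αw + βx + φ gives w = αx + βσ⁻¹(x) + φ, which
    -- is `h'`.
    have h : (twist α β φ hβ).symm (X 1) = X 0 := by
      rw [AlgEquiv.symm_apply_eq, twist_X_zero]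
    have h' := congrArg (twist α β φ hβ).symm (twist_X_one α β φ hβ)
    rw [map_add, map_add, map_smul, map_smul, h, AlgEquiv.symm_apply_apply, ← algebraMap_eq,
      AlgEquiv.commutes, algebraMap_eq, smul_eq_C_mul, smul_eq_C_mul] at h'
    simp [pow_two, twist_X_zero, h, smul_eq_C_mul, mul_assoc]
    generalize (twist α β φ hβ).symm (g (k + 1)) = y
    linear_combination y * X 0 * h'

/-- Evaluate at the sequence with 1 in position 0. Then d^k moves it to position k and (du)^j
multiplies by w^j. The outer powers of u are separated by divisibility: every value of u is a
multiple of x. -/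
theorem linearIndependent_model :
    LinearIndependent F fun p : ℕ × ℕ × ℕ => modelU α β φ hβ ^ p.1 *
      (modelD α β φ hβ * modelU α β φ hβ) ^ p.2.1 * modelD α β φ hβ ^ p.2.2 := by
  set U := modelU α β φ hβ with hUdef
  set D := modelD α β φ hβ with hDdef
  have hD : ∀ k : ℕ, (D ^ k) (Pi.single 0 1) = Pi.single (k : ℤ) 1 := by
    intro k
    induction k with
    | zero => simp
    | succ k ih =>
      rw [pow_succ', Module.End.mul_apply, ih]
      ext1 l
      by_cases hl : l = k + 1
      · subst hl; simp [hDdef]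
      · have : l - 1 ≠ k := by lia
        simp [hDdef, hl, this]
  have hW : ∀ (j : ℕ) (k : ℤ), ((D * U) ^ j) (Pi.single k 1) = Pi.single k (X 1 ^ j) := by
    intro j k
    induction j with
    | zero => simp
    | succ j ih =>
      rw [pow_succ', Module.End.mul_apply, ih]
      ext1 l
      by_cases hl : l = k
      · subst hl; simp [hDdef, hUdef, twist_X_zero, pow_succ']
      · simp [hDdef, hUdef, hl]
  let ev : Module.End F (ℤ → MvPolynomial (Fin 2) F) →ₗ[F] (ℤ → MvPolynomial (Fin 2) F) :=
    LinearMap.applyₗ (Pi.single 0 1)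
  refine LinearIndependent.of_comp ev ?_
  -- π reads the coefficients of the pure powers of w in positions k ≥ 0, hence kills multiples of
  -- x.
  let π : (ℤ → MvPolynomial (Fin 2) F) →ₗ[F] (ℕ × ℕ → F) :=
    LinearMap.pi fun p => (lcoeff F (Finsupp.single 1 p.1)).comp (LinearMap.proj (p.2 : ℤ))
  have := linearIndependent_pow_apply U π
    (fun p : ℕ × ℕ => Pi.single (p.2 : ℤ) (X 1 ^ p.1)) ?_ ?_ ?_
  · convert! this using 2 with p
    simp [ev, hD, hW]
  · intro g h hgh
    ext1 k
    have := congrFun hgh (k - 1)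
    simpa [hUdef] using this
  · intro g
    ext1 p
    simp [π, hUdef, coeff_X_mul']
  · convert! Pi.linearIndependent_single_one (ℕ × ℕ) F using 1
    ext p r
    obtain ⟨j, k⟩ := p
    obtain ⟨j', k'⟩ := r
    by_cases hk : k' = k
    · subst hk
      simp [π, coeff_X_pow, Pi.single_apply, Finsupp.single_injective _ |>.eq_iff,
        @eq_comm _ j]
    · have : (k' : ℤ) ≠ k := by exact_mod_cast hk
      simp [π, this, hk]

end Model

-- Freeness and specialization to arbitrary β

universe v

open TensorProduct in
/-- Specialization of a free down-up algebra along `R₁ → R`. -/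
theorem IsDownUpPair.baseChange {R₁ R S : Type*} [CommRing R₁] [CommRing R] [Algebra R₁ R] [Ring S]
    [Algebra R₁ S] {α β φ : R₁} {u d : S} (h : IsDownUpPair α β (algebraMap R₁ S φ) u d) :
    IsDownUpPair (algebraMap R₁ R α) (algebraMap R₁ R β)
      (algebraMap R (R ⊗[R₁] S) (algebraMap R₁ R φ)) (1 ⊗ₜ[R₁] u) (1 ⊗ₜ[R₁] d) where
  comm_u := Algebra.commutes _ _
  comm_d := Algebra.commutes _ _
  ddu := by
    have := congrArg (Algebra.TensorProduct.includeRight (R := R₁) (A := R)) h.ddu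
    simp only [map_mul, map_add, map_pow, map_smul, AlgHom.commutes,
      Algebra.TensorProduct.includeRight_apply] at this
    rw [this, algebraMap_smul, algebraMap_smul, IsScalarTower.algebraMap_apply R₁ R (R ⊗[R₁] S)]
  duu := by
    have := congrArg (Algebra.TensorProduct.includeRight (R := R₁) (A := R)) h.duu
    simp only [map_mul, map_add, map_pow, map_smul, AlgHom.commutes,
      Algebra.TensorProduct.includeRight_apply] at this
    rw [this, algebraMap_smul, algebraMap_smul, IsScalarTower.algebraMap_apply R₁ R (R ⊗[R₁] S)]

theorem mul_mem_of_mem_adjoin {R S : Type*} [CommRing R] [Ring S] [Algebra R S]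
    {N : Submodule R S} {s : Set S} (hs : ∀ a ∈ s, ∀ y ∈ N, a * y ∈ N) {x : S}
    (hx : x ∈ Algebra.adjoin R s) : ∀ y ∈ N, x * y ∈ N := by
  induction hx using Algebra.adjoin_induction with
  | mem x hx => exact hs x hx
  | algebraMap r => intro y hy; rw [← Algebra.smul_def]; exact N.smul_mem r hy
  | add x z _ _ h₁ h₂ => intro y hy; rw [add_mul]; exact add_mem (h₁ y hy) (h₂ y hy)
  | mul x z _ _ h₁ h₂ => intro y hy; rw [mul_assoc]; exact h₁ _ (h₂ y hy)

theorem IsDownUpPair.span_eq_top {R S : Type*} [CommRing R] [Ring S]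
    [Algebra R S] {α β φ : R} {u d : S} (h : IsDownUpPair α β (algebraMap R S φ) u d)
    (hS : Algebra.adjoin R {u, d} = ⊤) :
    Submodule.span R (Set.range fun p : ℕ × ℕ × ℕ => u ^ p.1 * (d * u) ^ p.2.1 * d ^ p.2.2) = ⊤ := by
  set N := Submodule.span R
    (Set.range fun p : ℕ × ℕ × ℕ => u ^ p.1 * (d * u) ^ p.2.1 * d ^ p.2.2)
  let E : ℕ → Set S := fun _ => Set.range (algebraMap R S)
  have hE : ∀ l, ∀ e ∈ E l, algebraMap R S φ * e ∈ E (l + 2 * 1) := by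
    rintro l _ ⟨r, rfl⟩
    exact ⟨φ * r, map_mul _ _ _⟩
  have hle : ∀ j m, pbwSpan R u d E 1 j m ≤ N := by
    refine fun j m => Submodule.span_le.2 ?_
    rintro _ ⟨i, b, k, l, _, ⟨r, rfl⟩, _, _, rfl⟩
    rw [← Algebra.commutes, ← Algebra.smul_def]
    exact N.smul_mem _ (Submodule.subset_span ⟨(i, b, k), rfl⟩)
  have hmem : ∀ p : ℕ × ℕ × ℕ, ∃ j m,
      u ^ p.1 * (d * u) ^ p.2.1 * d ^ p.2.2 ∈ pbwSpan R u d E 1 j m := fun p => by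
    have := mem_pbwSpan (R := R) (u := u) (d := d) (i := p.1) (b := p.2.1) (k := p.2.2) (q := 1)
      (show (1 : S) ∈ E 0 from ⟨1, map_one _⟩) le_rfl le_rfl
    rw [mul_one] at this
    exact ⟨_, _, this⟩
  have hmul : ∀ a ∈ ({u, d} : Set S), ∀ y ∈ N, a * y ∈ N := by
    intro a ha y hy
    refine mul_mem_of_mul_mem_span ?_ hy
    rintro _ ⟨p, rfl⟩
    obtain ⟨j, m, hp⟩ := hmem p
    obtain rfl | rfl := ha
    · exact hle _ _ (u_mul_mem_pbwSpan hp)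
    · exact hle _ _ (h.d_mul_mem_pbwSpan hE hp)
  rw [eq_top_iff]
  intro x _
  have hx : x ∈ Algebra.adjoin R {u, d} := hS ▸ Algebra.mem_top
  simpa using mul_mem_of_mem_adjoin hmul hx 1 (Submodule.subset_span ⟨0, by simp⟩)

/-- The subalgebra generated by a down-up pair inside a larger algebra in which the monomials are
linearly independent is free on the monomials. -/
theorem IsDownUpPair.exists_basis_of_linearIndependent {R : Type*} {T : Type v} [CommRing R]
    [Ring T] [Algebra R T] {α β φ : R} {U D : T} (hUD : IsDownUpPair α β (algebraMap R T φ) U D)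
    (hli : LinearIndependent R
      (fun p : ℕ × ℕ × ℕ => U ^ p.1 * (D * U) ^ p.2.1 * D ^ p.2.2)) :
    ∃ (S : Type v) (_ : Ring S) (_ : Algebra R S) (u d : S),
      IsDownUpPair α β (algebraMap R S φ) u d ∧
      ∃ b : Module.Basis (ℕ × ℕ × ℕ) R S,
        ∀ p, b p = u ^ p.1 * (d * u) ^ p.2.1 * d ^ p.2.2 := by
  let S := Algebra.adjoin R {U, D}
  let u : S := ⟨U, Algebra.subset_adjoin (by simp)⟩
  let d : S := ⟨D, Algebra.subset_adjoin (by simp)⟩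
  have h : IsDownUpPair α β (algebraMap R S φ) u d :=
    ⟨Algebra.commutes _ _, Algebra.commutes _ _, Subtype.ext hUD.ddu, Subtype.ext hUD.duu⟩
  have hadj : Algebra.adjoin R {u, d} = ⊤ := by
    have := Algebra.adjoin_adjoin_coe_preimage (R := R) (s := {U, D})
    convert! this using 2
    ext x
    simp [u, d, Subtype.ext_iff, S]
  have hli' : LinearIndependent R
      (fun p : ℕ × ℕ × ℕ => u ^ p.1 * (d * u) ^ p.2.1 * d ^ p.2.2) :=
    LinearIndependent.of_comp S.val.toLinearMap hli
  exact ⟨S, inferInstance, inferInstance, u, d, h,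
    Module.Basis.mk hli' (h.span_eq_top hadj).ge, fun p => by simp⟩

theorem IsDownUpPair.restrictScalars {R F S : Type*} [CommRing R] [CommRing F] [Algebra R F]
    [Ring S] [Algebra R S] [Algebra F S] [IsScalarTower R F S] {α β φ : R} {u d : S}
    (h : IsDownUpPair (algebraMap R F α) (algebraMap R F β) (algebraMap F S (algebraMap R F φ))
      u d) : IsDownUpPair α β (algebraMap R S φ) u d := by
  rw [← IsScalarTower.algebraMap_apply] at h
  refine ⟨h.comm_u, h.comm_d, ?_, ?_⟩
  · simpa only [algebraMap_smul] using h.ddu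
  · simpa only [algebraMap_smul] using h.duu

theorem exists_basis_of_ne_zero (R : Type v) [CommRing R] [IsDomain R] (α β φ : R)
    (hβ : β ≠ 0) : ∃ (S : Type v) (_ : Ring S) (_ : Algebra R S) (u d : S),
      IsDownUpPair α β (algebraMap R S φ) u d ∧
      ∃ b : Module.Basis (ℕ × ℕ × ℕ) R S,
        ∀ p, b p = u ^ p.1 * (d * u) ^ p.2.1 * d ^ p.2.2 := by
  have hβ' : algebraMap R (FractionRing R) β ≠ 0 := by simpa using hβ
  have h := isDownUpPair_model (algebraMap R (FractionRing R) α) _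
    (algebraMap R (FractionRing R) φ) hβ'
  exact h.restrictScalars.exists_basis_of_linearIndependent
    ((linearIndependent_model _ _ _ hβ').restrict_scalars' R)

open Polynomial in
theorem exists_linearIndependent_isDownUpPair {R : Type v} [CommRing R] [IsDomain R] (α β φ : R) :
    ∃ (B : Type v) (_ : Ring B) (_ : Algebra R B) (u d : B),
      IsDownUpPair α β (algebraMap R B φ) u d ∧
      LinearIndependent R (fun p : ℕ × ℕ × ℕ => u ^ p.1 * (d * u) ^ p.2.1 * d ^ p.2.2) := by
  obtain ⟨S, _, _, u, d, h, b, hb⟩ :=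
    -- The indeterminate X replaces β; it is nonzero even when β is zero.
    exists_basis_of_ne_zero R[X] (C α) X (C φ) X_ne_zero
  let _ : Algebra R[X] R := (evalRingHom β).toAlgebra
  have hα (r : R) : algebraMap R[X] R (C r) = r := eval_C
  have hβ : algebraMap R[X] R X = β := eval_X
  have h' := h.baseChange (R := R)
  rw [hα, hα, hβ] at h'
  refine ⟨_, _, _, _, _, h', ?_⟩
  convert! (Algebra.TensorProduct.basis R b).linearIndependent using 2 with p
  simp [hb]

/-! ### Ordered monomials in commuting variables -/

namespace DownUp

variable {K : Type*} [Field K] {n : ℕ}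

theorem map_orderedMonomial {A B F : Type*} [Monoid A] [Monoid B] [FunLike F A B]
    [MonoidHomClass F A B] (g : F) (x : Fin n → A) (m : Fin n → ℕ) :
    g (orderedMonomial x m) = orderedMonomial (fun i => g (x i)) m := by
  simp [orderedMonomial, map_list_prod, List.map_ofFn, Function.comp_def]

theorem map_orderedEval {A B : Type*} [Ring A] [Algebra K A] [Ring B] [Algebra K B]
    (g : A →ₐ[K] B) (x : Fin n → A) (φ : MvPolynomial (Fin n) K) :
    g (orderedEval x φ) = orderedEval (fun i => g (x i)) φ := by
  simp [orderedEval, map_orderedMonomial]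

theorem orderedMonomial_X (m : Fin n → ℕ) :
    orderedMonomial (MvPolynomial.X : Fin n → MvPolynomial (Fin n) K) m =
      MvPolynomial.monomial (Finsupp.equivFunOnFinite.symm m) 1 := by
  rw [orderedMonomial, List.prod_ofFn, MvPolynomial.monomial_eq, map_one, one_mul,
    Finsupp.prod_fintype _ _ (by simp)]
  simp

theorem orderedEval_X (φ : MvPolynomial (Fin n) K) :
    orderedEval (MvPolynomial.X : Fin n → MvPolynomial (Fin n) K) φ = φ := by
  conv_rhs => rw [← MvPolynomial.support_sum_monomial_coeff φ]
  refine Finset.sum_congr rfl fun m _ => ?_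
  rw [orderedMonomial_X, MvPolynomial.smul_monomial, smul_eq_mul, mul_one]
  congr 2
  ext
  rfl

end DownUp

/-! ### The central polynomials, the monomials and the weight filtration -/

namespace DownUpAlgebra

open DownUp

variable {K : Type*} [Field K] {n : ℕ} (α β : K) (φ : MvPolynomial (Fin n) K)

theorem adjoin_range_gen : Algebra.adjoin K (Set.range (gen α β φ)) = ⊤ := by
  have h := congrArg (Subalgebra.map (RingQuot.mkAlgHom K (Rel α β φ)))
    (FreeAlgebra.adjoin_range_ι K (DownUpGen n))
  rw [AlgHom.map_adjoin, ← Set.range_comp, Algebra.map_top,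
    (AlgHom.range_eq_top _).2 (RingQuot.mkAlgHom_surjective K _)] at h
  exact h

theorem t_comm_gen (i : Fin n) (x : DownUpGen n) :
    t α β φ i * gen α β φ x = gen α β φ x * t α β φ i := by
  cases x with
  | u => simpa using! RingQuot.mkAlgHom_rel K (Rel.t_comm_u (α := α) (β := β) (φ := φ) i)
  | d => simpa using! RingQuot.mkAlgHom_rel K (Rel.t_comm_d (α := α) (β := β) (φ := φ) i)
  | t j => simpa using! RingQuot.mkAlgHom_rel K (Rel.t_comm_t (α := α) (β := β) (φ := φ) i j)

theorem t_mem_center (i : Fin n) : t α β φ i ∈ Subalgebra.center K (DownUpAlgebra α β φ) := by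
  have h : Algebra.adjoin K (Set.range (gen α β φ)) ≤ Subalgebra.centralizer K {t α β φ i} := by
    refine Algebra.adjoin_le ?_
    rintro _ ⟨x, rfl⟩
    rw [SetLike.mem_coe, Subalgebra.mem_centralizer_iff]
    rintro _ rfl
    exact t_comm_gen α β φ i x
  rw [adjoin_range_gen] at h
  rw [Subalgebra.mem_center_iff]
  intro b
  exact ((Subalgebra.mem_centralizer_iff K).1 (h Algebra.mem_top) _ rfl).symm

/-- The central embedding of `K[t_1, …, t_n]`. -/
noncomputable def polyHom : MvPolynomial (Fin n) K →ₐ[K] DownUpAlgebra α β φ :=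
  (Subalgebra.center K _).val.comp (MvPolynomial.aeval fun i => ⟨t α β φ i, t_mem_center α β φ i⟩)

theorem polyHom_X (i : Fin n) : polyHom α β φ (MvPolynomial.X i) = t α β φ i := by
  simp [polyHom]

theorem commute_polyHom (p : MvPolynomial (Fin n) K) (x : DownUpAlgebra α β φ) :
    Commute (polyHom α β φ p) x :=
  ((Subalgebra.mem_center_iff.1 (Subtype.prop _)) x).symm

theorem orderedMonomial_t (m : Fin n → ℕ) : orderedMonomial (t α β φ) m =
    polyHom α β φ (MvPolynomial.monomial (Finsupp.equivFunOnFinite.symm m) 1) := by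
  rw [← orderedMonomial_X, map_orderedMonomial]
  simp only [polyHom_X]

theorem mk_orderedEval_freeT : RingQuot.mkAlgHom K (Rel α β φ) (orderedEval (freeT K n) φ) =
    polyHom α β φ φ := by
  have h := congrArg (polyHom α β φ) (orderedEval_X φ)
  rw [map_orderedEval] at h
  rw [← h, map_orderedEval]
  simp only [polyHom_X]
  rfl

theorem isDownUpPair :
    IsDownUpPair α β (polyHom α β φ φ) (u α β φ) (d α β φ) where
  comm_u := commute_polyHom _ _ _ _ _
  comm_d := commute_polyHom _ _ _ _ _
  ddu := by
    have := RingQuot.mkAlgHom_rel K (Rel.ddu (α := α) (β := β) (φ := φ))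
    simp only [map_mul, map_add, map_pow, map_smul, mk_orderedEval_freeT] at this
    exact this
  duu := by
    have := RingQuot.mkAlgHom_rel K (Rel.duu (α := α) (β := β) (φ := φ))
    simp only [map_mul, map_add, map_pow, map_smul, mk_orderedEval_freeT] at this
    exact this

theorem linearIndependent_monomial : LinearIndependent K (monomial α β φ) := by
  let R := MvPolynomial (Fin n) K
  obtain ⟨B, _, _, U, D, h, hli⟩ := exists_linearIndependent_isDownUpPair
    (MvPolynomial.C (σ := Fin n) α) (MvPolynomial.C β) φ
  let _ : Algebra K B := Algebra.compHom B (algebraMap K R)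
  have : IsScalarTower K R B := .of_algebraMap_eq' rfl
  let ι : R →ₐ[K] B := IsScalarTower.toAlgHom K R B
  have hC (a : K) (x : B) : (MvPolynomial.C a : R) • x = a • x := algebraMap_smul R a x
  let g₀ : FreeAlgebra K (DownUpGen n) →ₐ[K] B := FreeAlgebra.lift K fun x => match x with
    | .u => U
    | .d => D
    | .t i => algebraMap R B (MvPolynomial.X i)
  have hu : g₀ (freeU K n) = U := FreeAlgebra.lift_ι_apply _ _
  have hd : g₀ (freeD K n) = D := FreeAlgebra.lift_ι_apply _ _
  have ht (i) : g₀ (freeT K n i) = ι (MvPolynomial.X i) := FreeAlgebra.lift_ι_apply _ _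
  have hφ : g₀ (orderedEval (freeT K n) φ) = algebraMap R B φ := by
    rw [map_orderedEval]
    simp only [ht]
    rw [← map_orderedEval, orderedEval_X]
    rfl
  have hg₀ : ∀ ⦃x y⦄, Rel α β φ x y → g₀ x = g₀ y := by
    intro x y hxy
    cases hxy with
    | t_comm_t i j => rw [map_mul, map_mul, ht, ht, ← map_mul, ← map_mul, mul_comm]
    | t_comm_u i => rw [map_mul, map_mul, ht, hu]; exact Algebra.commutes _ _
    | t_comm_d i => rw [map_mul, map_mul, ht, hd]; exact Algebra.commutes _ _
    | ddu =>
      have := h.ddu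
      rw [hC, hC] at this
      simpa only [map_mul, map_add, map_pow, map_smul, hu, hd, hφ] using this
    | duu =>
      have := h.duu
      rw [hC, hC] at this
      simpa only [map_mul, map_add, map_pow, map_smul, hu, hd, hφ] using this
  let g : DownUpAlgebra α β φ →ₐ[K] B := RingQuot.liftAlgHom K ⟨g₀, hg₀⟩
  have hg (x) : g (gen α β φ x) = g₀ (FreeAlgebra.ι K x) :=
    RingQuot.liftAlgHom_mkAlgHom_apply K g₀ hg₀ _
  have hgu : g (u α β φ) = U := (hg _).trans hu
  have hgd : g (d α β φ) = D := (hg _).trans hd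
  have hgt (i) : g (t α β φ i) = ι (MvPolynomial.X i) := (hg _).trans (ht i)
  refine LinearIndependent.of_comp g.toLinearMap ?_
  -- A K-basis of R times an R-independent family is K-independent.
  have hlin := linearIndependent_smul (MvPolynomial.basisMonomials (Fin n) K).linearIndependent hli
  let r : ℕ × ℕ × ℕ × (Fin n → ℕ) → (Fin n →₀ ℕ) × (ℕ × ℕ × ℕ) := fun e =>
    (Finsupp.equivFunOnFinite.symm e.2.2.2, e.1, e.2.1, e.2.2.1)
  have hr : Function.Injective r := by
    rintro ⟨i, j, k, m⟩ ⟨i', j', k', m'⟩ h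
    simpa [r, and_assoc, and_comm, and_left_comm] using h
  convert! hlin.comp r hr using 1
  funext ⟨i, j, k, m⟩
  simp only [Function.comp_apply, AlgHom.toLinearMap_apply, monomial, map_mul, map_pow, hgu, hgd,
    map_orderedMonomial, hgt, r, MvPolynomial.coe_basisMonomials]
  rw [← map_orderedMonomial, orderedMonomial_X, Algebra.smul_def]
  exact (Algebra.commutes _ _).symm

/-- The filtration of the down-up algebra in which `u`, `d` have weight `φ.totalDegree + 1` and
the `t_i` have weight one. -/
noncomputable def filtration (m : ℕ) : Submodule K (DownUpAlgebra α β φ) :=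
  pbwSpan K (u α β φ) (d α β φ) (fun l => polyHom α β φ '' {p | p.totalDegree ≤ l})
    (φ.totalDegree + 1) m m

/-- Since q ≥ 1, the weight bound already forces i + b ≤ m, so the auxiliary bound j can be dropped.
-/
theorem pbwSpan_le_filtration (j m : ℕ) :
    pbwSpan K (u α β φ) (d α β φ) (fun l => polyHom α β φ '' {p | p.totalDegree ≤ l})
      (φ.totalDegree + 1) j m ≤ filtration α β φ m := by
  refine Submodule.span_mono ?_
  rintro _ ⟨i, b, k, l, e, he, _, h2, rfl⟩
  refine ⟨i, b, k, l, e, he, ?_, h2, rfl⟩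
  nlinarith [Nat.zero_le (φ.totalDegree * (i + 2 * b + k))]

theorem filtration_mono {m m' : ℕ} (h : m ≤ m') : filtration α β φ m ≤ filtration α β φ m' :=
  pbwSpan_mono h h

variable {α β φ}

theorem u_mul_mem_filtration {m : ℕ} {x : DownUpAlgebra α β φ} (hx : x ∈ filtration α β φ m) :
    u α β φ * x ∈ filtration α β φ (m + (φ.totalDegree + 1)) :=
  pbwSpan_le_filtration α β φ _ _ (u_mul_mem_pbwSpan hx)

theorem polyHom_mul_mem_filtration {m l : ℕ} {p : MvPolynomial (Fin n) K} (hp : p.totalDegree ≤ l)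
    {x : DownUpAlgebra α β φ} (hx : x ∈ filtration α β φ m) :
    polyHom α β φ p * x ∈ filtration α β φ (m + l) := by
  refine mul_mem_of_mul_mem_span ?_ hx
  rintro _ ⟨i, b, k, l', _, ⟨p', hp', rfl⟩, h1, h2, rfl⟩
  rw [(commute_polyHom α β φ p _).eq, mul_assoc, ← map_mul]
  refine pbwSpan_le_filtration α β φ _ _
    (mem_pbwSpan (l := l' + l) ⟨p' * p, ?_, rfl⟩ le_rfl (by lia))
  exact (MvPolynomial.totalDegree_mul _ _).trans (Nat.add_le_add hp' hp)

theorem d_mul_mem_filtration {m : ℕ} {x : DownUpAlgebra α β φ} (hx : x ∈ filtration α β φ m) :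
    d α β φ * x ∈ filtration α β φ (m + (φ.totalDegree + 1)) := by
  refine pbwSpan_le_filtration α β φ _ _ ((isDownUpPair α β φ).d_mul_mem_pbwSpan ?_ hx)
  rintro l _ ⟨p, hp, rfl⟩
  rw [← map_mul]
  refine ⟨_, (MvPolynomial.totalDegree_mul φ p).trans ?_, rfl⟩
  have : p.totalDegree ≤ l := hp
  lia

theorem pow_mul_mem_filtration {a x : DownUpAlgebra α β φ} {q m : ℕ}
    (ha : ∀ m, ∀ y ∈ filtration α β φ m, a * y ∈ filtration α β φ (m + q))
    (hx : x ∈ filtration α β φ m) (i : ℕ) : a ^ i * x ∈ filtration α β φ (m + q * i) := by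
  induction i with
  | zero => simpa using hx
  | succ i ih =>
    rw [pow_succ', mul_assoc, mul_add_one, ← add_assoc]
    exact ha _ _ ih

/-- The factors of a monomial of x act on y one after another from the right: the central
polynomial, d^k, (du)^j, u^i, each raising the level by its weight. -/
theorem mul_mem_filtration {a b : ℕ} {x y : DownUpAlgebra α β φ} (hx : x ∈ filtration α β φ a)
    (hy : y ∈ filtration α β φ b) : x * y ∈ filtration α β φ (a + b) := by
  have : filtration α β φ a ≤ (filtration α β φ (a + b)).comap (LinearMap.mulRight K y) := by
    refine Submodule.span_le.2 ?_
    rintro _ ⟨i, j, k, l, _, ⟨p, hp, rfl⟩, h1, h2, rfl⟩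
    have h3 := polyHom_mul_mem_filtration hp hy
    have h4 := pow_mul_mem_filtration (fun m y hy => d_mul_mem_filtration hy) h3 k
    have h5 := pow_mul_mem_filtration (a := d α β φ * u α β φ) (q := 2 * (φ.totalDegree + 1))
      (fun m y hy => by
        rw [mul_assoc, two_mul, ← add_assoc]
        exact d_mul_mem_filtration (u_mul_mem_filtration hy)) h4 j
    have h6 := pow_mul_mem_filtration (fun m y hy => u_mul_mem_filtration hy) h5 i
    simp only [← mul_assoc] at h6
    exact filtration_mono α β φ (by ring_nf at h2 ⊢; lia) h6
  exact this hx

variable (α β φ)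

theorem one_mem_filtration : 1 ∈ filtration α β φ 0 := by
  have := pbwSpan_le_filtration α β φ 0 0
    (mem_pbwSpan (i := 0) (b := 0) (k := 0) (l := 0) (m := 0) ⟨1, by simp, rfl⟩ (by simp) (by simp))
  simpa using this

theorem gen_mem_filtration (x : DownUpGen n) :
    gen α β φ x ∈ filtration α β φ (φ.totalDegree + 1) := by
  cases x with
  | u => simpa using! u_mul_mem_filtration (one_mem_filtration α β φ)
  | d => simpa using! d_mul_mem_filtration (one_mem_filtration α β φ)
  | t i =>
    have := polyHom_mul_mem_filtration (MvPolynomial.totalDegree_X (R := K) i).le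
      (one_mem_filtration α β φ)
    rw [mul_one, polyHom_X] at this
    exact filtration_mono α β φ (by lia) this

theorem exists_mem_filtration (x : DownUpAlgebra α β φ) : ∃ m, x ∈ filtration α β φ m := by
  have hx : x ∈ Algebra.adjoin K (Set.range (gen α β φ)) := adjoin_range_gen α β φ ▸ Algebra.mem_top
  induction hx using Algebra.adjoin_induction with
  | mem x hx => obtain ⟨y, rfl⟩ := hx; exact ⟨_, gen_mem_filtration α β φ y⟩
  | algebraMap r =>
    rw [Algebra.algebraMap_eq_smul_one]
    exact ⟨0, Submodule.smul_mem _ _ (one_mem_filtration α β φ)⟩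
  | add x y _ _ hx hy =>
    obtain ⟨a, ha⟩ := hx
    obtain ⟨b, hb⟩ := hy
    exact ⟨max a b, add_mem (filtration_mono α β φ (le_max_left _ _) ha)
      (filtration_mono α β φ (le_max_right _ _) hb)⟩
  | mul x y _ _ hx hy =>
    obtain ⟨a, ha⟩ := hx
    obtain ⟨b, hb⟩ := hy
    exact ⟨a + b, mul_mem_filtration ha hb⟩

/-- The exponents all of whose entries are at most `m`. -/
def expBox (n m : ℕ) : Finset (ℕ × ℕ × ℕ × (Fin n → ℕ)) :=
  Finset.range (m + 1) ×ˢ Finset.range (m + 1) ×ˢ Finset.range (m + 1) ×ˢ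
    Fintype.piFinset fun _ => Finset.range (m + 1)

theorem mem_expBox {m : ℕ} {e : ℕ × ℕ × ℕ × (Fin n → ℕ)} :
    e ∈ expBox n m ↔ e.1 ≤ m ∧ e.2.1 ≤ m ∧ e.2.2.1 ≤ m ∧ ∀ i, e.2.2.2 i ≤ m := by
  simp [expBox]

theorem card_expBox (n m : ℕ) : (expBox n m).card = (m + 1) ^ (n + 3) := by
  simp [expBox]
  ring

theorem filtration_le_span (m : ℕ) :
    filtration α β φ m ≤ Submodule.span K (monomial α β φ '' (expBox n m : Set _)) := by
  refine Submodule.span_le.2 ?_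
  rintro _ ⟨i, b, k, l, _, ⟨p, hp, rfl⟩, h1, h2, rfl⟩
  have hp : p.totalDegree ≤ l := hp
  have hle : i + 2 * b + k + l ≤ m := by
    nlinarith [Nat.zero_le (φ.totalDegree * (i + 2 * b + k))]
  rw [← MvPolynomial.support_sum_monomial_coeff p, map_sum, Finset.mul_sum]
  refine sum_mem fun s hs => ?_
  rw [← mul_one (MvPolynomial.coeff s p), ← smul_eq_mul (MvPolynomial.coeff s p),
    ← MvPolynomial.smul_monomial, map_smul, mul_smul_comm]
  refine Submodule.smul_mem _ _ (Submodule.subset_span ⟨(i, b, k, s), ?_, ?_⟩)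
  · rw [Finset.mem_coe, mem_expBox]
    refine ⟨by dsimp; lia, by dsimp; lia, by dsimp; lia, fun a => ?_⟩
    have h3 := (Finsupp.le_degree a s).trans (MvPolynomial.le_totalDegree hs)
    dsimp
    lia
  · simp [monomial, orderedMonomial_t]

theorem span_range_monomial : Submodule.span K (Set.range (monomial α β φ)) = ⊤ := by
  rw [eq_top_iff]
  intro x _
  obtain ⟨m, hm⟩ := exists_mem_filtration α β φ x
  exact Submodule.span_mono (Set.image_subset_range _ _) (filtration_le_span α β φ m hm)

instance finiteDimensional_filtration (m : ℕ) : FiniteDimensional K (filtration α β φ m) := by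
  have : FiniteDimensional K (Submodule.span K (monomial α β φ '' (expBox n m : Set _))) :=
    FiniteDimensional.span_of_finite K ((expBox n m).finite_toSet.image _)
  exact Submodule.finiteDimensional_of_le (filtration_le_span α β φ m)

theorem finrank_filtration_le (m : ℕ) :
    Module.finrank K (filtration α β φ m) ≤ (m + 1) ^ (n + 3) := by
  classical
  have : FiniteDimensional K (Submodule.span K (monomial α β φ '' (expBox n m : Set _))) :=
    FiniteDimensional.span_of_finite K ((expBox n m).finite_toSet.image _)
  refine (Submodule.finrank_mono (filtration_le_span α β φ m)).trans ?_
  rw [← Finset.coe_image, ← card_expBox n m]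
  exact (finrank_span_finset_le_card _).trans Finset.card_image_le

end DownUpAlgebra


/-! ### Growth exponents -/

open Filter Topology

/-- With log c in place of c, this says that the constant c in a bound (cm)^N does not affect the
growth exponent. -/
theorem tendsto_mul_log_add_div_log (N c : ℝ) :
    Tendsto (fun m : ℕ => N * (c + Real.log m) / Real.log m) atTop (𝓝 N) := by
  have hlog : Tendsto (fun m : ℕ => Real.log m) atTop atTop :=
    Real.tendsto_log_atTop.comp tendsto_natCast_atTop_atTop
  have h : Tendsto (fun m : ℕ => N * (c / Real.log m + 1)) atTop (𝓝 (N * (0 + 1))) :=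
    ((hlog.const_div_atTop c).add_const 1).const_mul N
  rw [zero_add, mul_one] at h
  refine h.congr' ?_
  filter_upwards [hlog.eventually_gt_atTop 0] with m hm
  field_simp

theorem log_pow_mul {N m : ℕ} {c : ℝ} (hc : 0 < c) (hm : 1 < m) :
    Real.log ((c * m) ^ N) = N * (Real.log c + Real.log m) := by
  rw [Real.log_pow, Real.log_mul hc.ne' (by positivity)]

theorem limsup_log_div_log_le {D : ℕ → ℕ} {N : ℕ} {c : ℝ} (hc : 0 < c)
    (hD : ∀ m, 1 < m → 0 < D m ∧ (D m : ℝ) ≤ (c * m) ^ N) :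
    limsup (fun m : ℕ => ((Real.log (D m) / Real.log m : ℝ) : EReal)) atTop ≤ (N : ℝ) := by
  have h := (continuous_coe_real_ereal.tendsto _).comp
    (tendsto_mul_log_add_div_log N (Real.log c))
  rw [← h.limsup_eq]
  refine limsup_le_limsup ?_
  filter_upwards [eventually_gt_atTop 1] with m hm
  have hlog : 0 < Real.log m := Real.log_pos (by exact_mod_cast hm)
  obtain ⟨h0, h1⟩ := hD m hm
  rw [Function.comp_apply, EReal.coe_le_coe_iff, ← log_pow_mul hc hm]
  gcongr

theorem le_limsup_log_div_log {D : ℕ → ℕ} {N : ℕ} {c : ℝ} (hc : 0 < c)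
    (hD : ∀ m, 1 < m → (c * m) ^ N ≤ (D m : ℝ)) :
    ((N : ℝ) : EReal) ≤
      limsup (fun m : ℕ => ((Real.log (D m) / Real.log m : ℝ) : EReal)) atTop := by
  have h := (continuous_coe_real_ereal.tendsto _).comp
    (tendsto_mul_log_add_div_log N (Real.log c))
  rw [← h.limsup_eq]
  refine limsup_le_limsup ?_
  filter_upwards [eventually_gt_atTop 1] with m hm
  have hlog : 0 < Real.log m := Real.log_pos (by exact_mod_cast hm)
  have h1 := hD m hm
  rw [Function.comp_apply, EReal.coe_le_coe_iff, ← log_pow_mul hc hm]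
  gcongr

theorem DownUp.orderedMonomial_mem_pow {K A : Type*} [Field K] [Ring A] [Algebra K A]
    {V : Submodule K A} {n : ℕ} {x : Fin n → A} (hx : ∀ i, x i ∈ V) (m : Fin n → ℕ) :
    orderedMonomial x m ∈ V ^ ∑ i, m i := by
  induction n with
  | zero => simpa [orderedMonomial] using ⟨1, map_one (algebraMap K A)⟩
  | succ n ih =>
    rw [Fin.sum_univ_succ, pow_add, orderedMonomial, List.ofFn_succ, List.prod_cons]
    exact Submodule.mul_mem_mul (Submodule.pow_mem_pow V (hx 0) _)
      (ih (fun i => hx i.succ) fun i => m i.succ)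

/-! ### The Gelfand–Kirillov dimension -/

namespace DownUpAlgebra

variable {K : Type*} [Field K] {n : ℕ} (α β : K) (φ : MvPolynomial (Fin n) K)

theorem exists_le_filtration (V : Submodule K (DownUpAlgebra α β φ)) [FiniteDimensional K V] :
    ∃ s, V ≤ filtration α β φ s := by
  obtain ⟨t, rfl⟩ := (Submodule.fg_iff_finiteDimensional V).2 inferInstance
  choose f hf using exists_mem_filtration α β φ
  exact ⟨t.sup f, Submodule.span_le.2 fun x hx =>
    filtration_mono α β φ (Finset.le_sup hx) (hf x)⟩

variable {α β φ}

theorem pow_le_filtration {V : Submodule K (DownUpAlgebra α β φ)} {s : ℕ}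
    (hV : V ≤ filtration α β φ s) (i : ℕ) : V ^ i ≤ filtration α β φ (s * i) := by
  induction i with
  | zero =>
    rw [pow_zero, Submodule.one_le]
    exact one_mem_filtration α β φ
  | succ i ih =>
    rw [pow_succ, mul_add_one, Submodule.mul_le]
    exact fun x hx y hy => mul_mem_filtration (ih hx) (hV hy)

theorem iSup_pow_le_filtration {V : Submodule K (DownUpAlgebra α β φ)} {s : ℕ}
    (hV : V ≤ filtration α β φ s) (m : ℕ) :
    ⨆ i ∈ Finset.range (m + 1), V ^ i ≤ filtration α β φ (s * m) := by
  refine iSup₂_le fun i hi => (pow_le_filtration hV i).trans (filtration_mono α β φ ?_)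
  exact Nat.mul_le_mul_left s (Nat.lt_succ_iff.1 (Finset.mem_range.1 hi))

theorem finiteDimensional_iSup_pow {V : Submodule K (DownUpAlgebra α β φ)}
    [FiniteDimensional K V] (m : ℕ) :
    FiniteDimensional K (⨆ i ∈ Finset.range (m + 1), V ^ i : Submodule K _) := by
  obtain ⟨s, hs⟩ := exists_le_filtration α β φ V
  exact Submodule.finiteDimensional_of_le (iSup_pow_le_filtration hs m)

variable (α β φ)

/-- The span of `1` and the generators. -/
noncomputable def genSpan : Submodule K (DownUpAlgebra α β φ) :=
  1 ⊔ Submodule.span K (Set.range (gen α β φ))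

instance : Finite (DownUpGen n) :=
  Finite.of_surjective (fun x : Bool ⊕ Fin n => match x with
    | .inl true => .u
    | .inl false => .d
    | .inr i => .t i) (by
      rintro (_ | _ | i)
      exacts [⟨.inl true, rfl⟩, ⟨.inl false, rfl⟩, ⟨.inr i, rfl⟩])

instance finiteDimensional_genSpan : FiniteDimensional K (genSpan α β φ) := by
  have : FiniteDimensional K (Submodule.span K (Set.range (gen α β φ))) :=
    FiniteDimensional.span_of_finite K (Set.finite_range _)
  have : FiniteDimensional K (1 : Submodule K (DownUpAlgebra α β φ)) := by
    rw [Submodule.one_eq_span]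
    infer_instance
  exact Submodule.finiteDimensional_sup _ _

theorem gen_mem_genSpan (x : DownUpGen n) : gen α β φ x ∈ genSpan α β φ :=
  Submodule.mem_sup_right (Submodule.subset_span ⟨x, rfl⟩)

theorem monomial_mem_genSpan_pow (e : ℕ × ℕ × ℕ × (Fin n → ℕ)) :
    monomial α β φ e ∈ genSpan α β φ ^ (e.1 + 2 * e.2.1 + e.2.2.1 + ∑ i, e.2.2.2 i) := by
  have hu : u α β φ ∈ genSpan α β φ := gen_mem_genSpan α β φ _
  have hd : d α β φ ∈ genSpan α β φ := gen_mem_genSpan α β φ _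
  have hdu : d α β φ * u α β φ ∈ genSpan α β φ ^ 2 := by
    rw [pow_two]
    exact Submodule.mul_mem_mul hd hu
  rw [pow_add, pow_add, pow_add, pow_mul]
  exact Submodule.mul_mem_mul (Submodule.mul_mem_mul (Submodule.mul_mem_mul
    (Submodule.pow_mem_pow _ hu _) (Submodule.pow_mem_pow _ hdu _))
    (Submodule.pow_mem_pow _ hd _))
    (DownUp.orderedMonomial_mem_pow (fun i => gen_mem_genSpan α β φ _) _)

/-- A monomial with all exponents at most L has length at most L + 2L + L + nL = (n+4)L, as du
counts twice. There are (L+1)^(n+3) of these and they are independent. -/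
theorem le_finrank_iSup_genSpan_pow (m : ℕ) : (m / (n + 4) + 1) ^ (n + 3) ≤
    Module.finrank K (⨆ i ∈ Finset.range (m + 1), genSpan α β φ ^ i : Submodule K _) := by
  set L := m / (n + 4)
  have hL : (n + 4) * L ≤ m := Nat.mul_div_le m (n + 4)
  have hli : LinearIndependent K fun e : expBox n L => monomial α β φ e :=
    (linearIndependent_monomial α β φ).comp _ Subtype.val_injective
  rw [← card_expBox n L, ← Fintype.card_coe, ← finrank_span_eq_card hli]
  have := finiteDimensional_iSup_pow (V := genSpan α β φ) m
  refine Submodule.finrank_mono (Submodule.span_le.2 ?_)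
  rintro _ ⟨⟨e, he⟩, rfl⟩
  obtain ⟨h1, h2, h3, h4⟩ := mem_expBox.1 he
  have h5 : ∑ i, e.2.2.2 i ≤ n * L := by
    simpa using Finset.sum_le_card_nsmul Finset.univ e.2.2.2 L fun i _ => h4 i
  refine Submodule.mem_iSup_of_mem _ (Submodule.mem_iSup_of_mem (Finset.mem_range.2 ?_)
    (monomial_mem_genSpan_pow α β φ e))
  have : (n + 4) * L = n * L + 4 * L := by ring
  lia

theorem gelfandKirillovDim_eq :
    gelfandKirillovDim K (DownUpAlgebra α β φ) = (n : EReal) + 3 := by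
  have hn : (n : EReal) + 3 = (((n + 3 : ℕ) : ℝ) : EReal) := by push_cast; rfl
  rw [hn]
  refine le_antisymm (iSup₂_le fun V _ => ?_) (le_iSup₂_of_le (genSpan α β φ) inferInstance ?_)
  · obtain ⟨s, hs⟩ := exists_le_filtration α β φ V
    -- For m ≥ 1, sm + 1 ≤ (s+1)m; the constant s + 1 is positive even if s = 0.
    refine limsup_log_div_log_le (c := s + 1) (by positivity) fun m hm => ⟨?_, ?_⟩
    · have := finiteDimensional_iSup_pow (V := V) m
      have hnt : Nontrivial (DownUpAlgebra α β φ) :=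
        ⟨_, _, (linearIndependent_monomial α β φ).ne_zero 0⟩
      refine Submodule.one_le_finrank_iff.2 fun h => ?_
      have h1 : (1 : DownUpAlgebra α β φ) ∈ (⨆ i ∈ Finset.range (m + 1), V ^ i : Submodule K _) :=
        -- V^0 contains 1, so the dimension is positive even for V = 0 and the logarithm can be
        -- compared.
        Submodule.mem_iSup_of_mem 0 (Submodule.mem_iSup_of_mem (by simp) (by simp))
      rw [h] at h1
      exact one_ne_zero h1
    · have h1 := (Submodule.finrank_mono (iSup_pow_le_filtration hs m)).trans
        (finrank_filtration_le α β φ (s * m))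
      refine (Nat.cast_le.2 h1).trans ?_
      have : (1 : ℝ) ≤ m := by exact_mod_cast hm.le
      push_cast
      gcongr
      linarith
  · refine le_limsup_log_div_log (c := 1 / (n + 4)) (by positivity) fun m hm => ?_
    refine le_trans ?_ (Nat.cast_le.2 (le_finrank_iSup_genSpan_pow α β φ m))
    push_cast
    gcongr
    have := (Nat.lt_div_mul_add (a := m) (b := n + 4) (by lia)).le
    have h2 : (m : ℝ) ≤ (m / (n + 4) : ℕ) * (n + 4) + (n + 4) := by exact_mod_cast this
    rw [one_div, inv_mul_le_iff₀ (by positivity)]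
    linarith

end DownUpAlgebra

theorem theorem1p2 {K : Type*} [Field K] (n : ℕ) (α β : K) (φ : MvPolynomial (Fin n) K) :
    (LinearIndependent K (DownUpAlgebra.monomial α β φ) ∧
      Submodule.span K (Set.range (DownUpAlgebra.monomial α β φ)) = ⊤) ∧
    gelfandKirillovDim K (DownUpAlgebra α β φ) = (n : EReal) + 3 :=
  ⟨⟨DownUpAlgebra.linearIndependent_monomial α β φ, DownUpAlgebra.span_range_monomial α β φ⟩,
    DownUpAlgebra.gelfandKirillovDim_eq α β φ⟩
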